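/- **Notation.** For a unit vector $|\varphi\rangle$ in an $N$-partite space $H_1\otimes\cdots\otimes H_N$ of finite dimension, put $$C_N(|\varphi\rangle)=2^{1-\frac N2}\sqrt{(2^N-2)-\sum_\alpha \mathrm{tr}(\rho_\alpha^2)},$$ where $\alpha$ runs over the $2^N-2$ nonempty proper subsets of $\{1,\dots,N\}$ and $\rho_\alpha=\mathrm{tr}_{\bar\alpha}|\varphi\rangle\langle\varphi|$. For a positive semidefinite operator $\rho$ on $H_1\otimes\cdots\otimes H_N$, put $$C_N(\rho)=\inf\sum_k p_k\,C_N(|\varphi_k\rangle),$$ the infimum (which is a minimum) being taken over all finite decompositions $\rho=\sum_k p_k|\varphi_k\rangle\langle\varphi_k|$ with $p_k\ge 0$ and unit vectors $|\varphi_k\rangle$. Here $\sum_k p_k=\mathrm{tr}\,\rho$, which is $1$ for a normalized state; for unnormalized operators $C_N(c\rho)=c\,C_N(\rho)$ for all $c\ge 0$. For an operator $\rho$ on $\mathbb C^{d_1}\otimes\mathbb C^{d_2}\otimes\mathbb C^{d_3}$ and labels $i_1<i_2$ in $\{1,\dots,d_1\}$, $j_1<j_2$ in $\{1,\dots,d_2\}$,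 $k_1<k_2$ in $\{1,\dots,d_3\}$, the corresponding three-qubit substate $\rho_{2\otimes2\otimes2}$ is the (unnormalized) $8\times 8$ block of $\rho$ in the product basis whose row and column labels $ijk$ satisfy $i\in\{i_1,i_2\}$, $j\in\{j_1,j_2\}$, $k\in\{k_1,k_2\}$. For $1\le m<n\le 3$, $C_{mn}(\rho_{2\otimes2\otimes2})$ denotes the two-qubit concurrence $C_2$ of the (unnormalized) reduced matrix of $\rho_{2\otimes2\otimes2}$ on the qubits $m$ and $n$. **Theorem 1.** Let $d_1,d_2,d_3\ge 2$ and let $\rho$ be a mixed state (a positive semidefinite operator of trace $1$) on $\mathbb C^{d_1}\otimes\mathbb C^{d_2}\otimes\mathbb C^{d_3}$. Then $$C_3(\rho)\ \ge\ \frac{1}{\sqrt{(d_1-1)(d_2-1)(d_3-1)}}\Big[\sum\ \sum_{1\le m<n\le 3} C_{mn}^2(\rho_{2\otimes2\otimes2})\Big]^{1/2},$$ where the outer sum runs over all $\binom{d_1}{2}\binom{d_2}{2}\binom{d_3}{2}$ three-qubit substates $\rho_{2\otimes2\otimes2}$ of $\rho$. -/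

import Mathlib

open scoped ComplexOrder

noncomputable section

/-- The computational product basis of `H_1 ⊗ ⋯ ⊗ H_N`, where the parties are labelled by `ι` and
`dim H_i = d i`. -/
abbrev BasisIdx {ι : Type} (d : ι → ℕ) : Type := (i : ι) → Fin (d i)

/-- Operators on `⨂ i, ℂ^(d i)`, as matrices in the product basis. -/
abbrev Op {ι : Type} (d : ι → ℕ) : Type := Matrix (BasisIdx d) (BasisIdx d) ℂ

/-- Vectors of `⨂ i, ℂ^(d i)`, through their amplitudes `a_{i j k ...}` in the product basis. -/
abbrev PureVec {ι : Type} [Fintype ι] [DecidableEq ι] (d : ι → ℕ) : Type :=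
  EuclideanSpace ℂ (BasisIdx d)

/-- A (normalized) mixed quantum state. -/
def IsState {ι : Type} [Fintype ι] [DecidableEq ι] {d : ι → ℕ} (ρ : Op d) : Prop :=
  ρ.PosSemidef ∧ ρ.trace = 1

/-- The rank-one operator `|φ⟩⟨φ|`. -/
def ketbra {ι : Type} [Fintype ι] [DecidableEq ι] {d : ι → ℕ} (φ : PureVec d) : Op d :=
  Matrix.of fun x y => φ x * star (φ y)

/-- The basis element of the whole system with label `x` on the parties in `α` and label `z` on
the remaining parties. -/
def glue {ι : Type} [DecidableEq ι] {d : ι → ℕ} (α : Finset ι)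
    (x : BasisIdx (fun i : {i // i ∈ α} => d i)) (z : BasisIdx (fun i : {i // i ∉ α} => d i)) :
    BasisIdx d :=
  fun i => if h : i ∈ α then x ⟨i, h⟩ else z ⟨i, h⟩

/-- The reduced matrix `ρ_α = tr_{ᾱ} ρ` on the parties in `α`: the partial trace over all parties
that are not in `α`. -/
def reducedState {ι : Type} [Fintype ι] [DecidableEq ι] {d : ι → ℕ} (α : Finset ι) (ρ : Op d) :
    Op (fun i : {i // i ∈ α} => d i) :=
  Matrix.of fun x y => ∑ z : BasisIdx (fun i : {i // i ∉ α} => d i), ρ (glue α x z) (glue α y z)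

/-- The concurrence of an `N`-partite pure state (a unit vector),
`2^(1 - N/2) * √((2^N - 2) - ∑_α tr (ρ_α²))`, where `α` runs over the `2^N - 2` nonempty proper
subsets of the set of parties. -/
def pureConcurrence {ι : Type} [Fintype ι] [DecidableEq ι] {d : ι → ℕ} (φ : PureVec d) : ℝ :=
  (2 : ℝ) ^ (1 - (Fintype.card ι : ℝ) / 2) *
    √(((2 : ℝ) ^ Fintype.card ι - 2) -
      ∑ α : Finset ι with α.Nonempty ∧ α ≠ Finset.univ,
        ((reducedState α (ketbra φ) ^ 2).trace).re)

/-- The average concurrences of the finite ensembles `{p_k, φ_k}` of pure states that realize `ρ`,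
`ρ = ∑ k, p_k |φ_k⟩⟨φ_k|` with `p_k ≥ 0` and unit vectors `φ_k`.
Taking traces gives `∑ k, p_k = tr ρ`, so the weights are a probability vector if `ρ` is a
normalized state. -/
def ensembleAverages {ι : Type} [Fintype ι] [DecidableEq ι] {d : ι → ℕ} (ρ : Op d) : Set ℝ :=
  {c | ∃ (n : ℕ) (p : Fin n → ℝ) (φ : Fin n → PureVec d),
    (∀ k, 0 ≤ p k) ∧ (∀ k, ‖φ k‖ = 1) ∧
    ρ = ∑ k, (p k : ℂ) • ketbra (φ k) ∧
    c = ∑ k, p k * pureConcurrence (φ k)}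

/-- The concurrence of a positive semidefinite matrix, by the convex roof. On normalized states this
is the usual concurrence; on an unnormalized `ρ ≠ 0` it equals `tr ρ` times the concurrence of the
state `ρ / tr ρ`, and it is `0` at `ρ = 0`. -/
def concurrence {ι : Type} [Fintype ι] [DecidableEq ι] {d : ι → ℕ} (ρ : Op d) : ℝ :=
  sInf (ensembleAverages ρ)

/-- A choice of two basis labels, the smaller one first, for each party. -/
abbrev QubitChoice {ι : Type} (d : ι → ℕ) : Type := (i : ι) → Fin 2 ↪o Fin (d i)

/-- The (unnormalized) multi-qubit substate of `ρ` for a choice of two basis labels per party: the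
block of `ρ` whose rows and columns carry the chosen labels only. -/
def qubitSubstate {ι : Type} {d : ι → ℕ} (ρ : Op d) (f : QubitChoice d) :
    Op (fun _ : ι => 2) :=
  ρ.submatrix (fun x i => f i (x i)) (fun x i => f i (x i))

end

/-! ### Counting how often a pair of labels occurs among the two-label choices. -/

section CountingPairs

/-! Both sides are controlled by two copies of a pure state φ. Let S_α exchange the labels of the
two copies on α. These involutions commute, S_α S_β = S_(α ∆ β), and ⟨φφ|S_α|φφ⟩ = tr ρ_α². The
function `flipAmp` is (1 - S_α)(1 - S_β) applied to φ ⊗ φ. Since (1 - S)² = 2(1 - S), its squared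
norm for a unit vector is 4(1 + tr ρ_(α∆β)² - tr ρ_α² - tr ρ_β²). For three parties complementary
purities agree, and summing over the pairs of parties gives 4 C_3(φ)² (`pureConcurrence_three`).

Now fix a substate and two parties m, n. A pure φ contributes the reduced matrix |v_0⟩⟨v_0| +
|v_1⟩⟨v_1|, where v_z is the slice of φ at the label z of the third qubit. A unitary mixing makes
one of the two vectors isotropic for the spin-flip form. Hence the two-qubit concurrence is at most
the Frobenius norm of the 2 × 2 matrix of that form on v_0, v_1, whose entries are values of
`flipAmp` (`exists_ketbra_add_isotropic`).

In the sum over substates a value of `flipAmp` recurs at most d_p - 1 times, p being the third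
party, and d_p - 1 is at most the product of all three factors (`sum_substates_le_pureConcurrence`).
A weighted Minkowski inequality extends the bound from pure states to every ensemble, hence to the
infimum. -/

theorem sum_orderEmb_eq_sum_lt {n : ℕ} (h : Fin n → Fin n → ℝ) :
    ∑ f : Fin 2 ↪o Fin n, h (f 0) (f 1) = ∑ i, ∑ j, if i < j then h i j else 0 := by
  rw [← Fintype.sum_prod_type', ← Finset.sum_filter]
  refine Finset.sum_bij (fun f _ => (f 0, f 1)) ?_ ?_ ?_ ?_
  · intro f _
    simp
  · intro f _ g _ hfg
    simp only [Prod.mk.injEq] at hfg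
    ext i
    fin_cases i
    · simp [hfg.1]
    · simp [hfg.2]
  · rintro ⟨i, j⟩ hij
    simp only [Finset.mem_filter, Finset.mem_univ, true_and] at hij
    have hmono : StrictMono ![i, j] := by
      intro a b hab
      fin_cases a <;> fin_cases b <;> simp_all
    exact ⟨OrderEmbedding.ofStrictMono ![i, j] hmono, Finset.mem_univ _, rfl⟩
  · intro f _
    rfl

theorem two_mul_sum_orderEmb {n : ℕ} (h : Fin n → Fin n → ℝ) (hs : ∀ i j, h i j = h j i)
    (h0 : ∀ i, h i i = 0) :
    2 * ∑ f : Fin 2 ↪o Fin n, h (f 0) (f 1) = ∑ i, ∑ j, h i j := by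
  have hswap : ∑ i, ∑ j, (if i < j then h i j else 0) = ∑ i, ∑ j, if j < i then h j i else 0 :=
    Finset.sum_comm
  rw [two_mul, sum_orderEmb_eq_sum_lt]
  nth_rw 2 [hswap]
  rw [← Finset.sum_add_distrib]
  refine Finset.sum_congr rfl fun i _ => ?_
  rw [← Finset.sum_add_distrib]
  refine Finset.sum_congr rfl fun j _ => ?_
  rcases lt_trichotomy i j with hij | hij | hij
  · simp [hij, hij.not_gt]
  · simp [hij, h0]
  · simp [hij, hij.not_gt, hs i j]

/-- An off-diagonal entry lies in exactly one 2 × 2 block, a diagonal entry in n - 1 of them. -/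
theorem sum_orderEmb_block_le {n : ℕ} (hn : 2 ≤ n) (h : Fin n → Fin n → ℝ)
    (hpos : ∀ i j, 0 ≤ h i j) :
    ∑ f : Fin 2 ↪o Fin n, ∑ k, ∑ l, h (f k) (f l) ≤ ((n : ℝ) - 1) * ∑ i, ∑ j, h i j := by
  -- The sum over the block on {i, j}, corrected to vanish at i = j so that `two_mul_sum_orderEmb`
  -- applies.
  let H : Fin n → Fin n → ℝ := fun i j =>
    (h i i + h j j + h i j + h j i) - if i = j then 4 * h i i else 0
  have hH := two_mul_sum_orderEmb H
    (fun i j => by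
      by_cases hij : i = j
      · simp [H, hij]
      · simp only [H, hij, Ne.symm hij, if_false]; ring)
    (fun i => by simp only [H, if_true]; ring)
  have e1 : ∑ f : Fin 2 ↪o Fin n, ∑ k, ∑ l, h (f k) (f l) = ∑ f : Fin 2 ↪o Fin n, H (f 0) (f 1) := by
    refine Finset.sum_congr rfl fun f _ => ?_
    simp [H, Fin.sum_univ_two]
    ring
  have e2 : ∑ i, ∑ j, H i j = 2 * ((n : ℝ) - 2) * ∑ i, h i i + 2 * ∑ i, ∑ j, h i j := by
    have hc : ∑ i, ∑ j, h j i = ∑ i, ∑ j, h i j := Finset.sum_comm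
    simp only [H, Finset.sum_sub_distrib, Finset.sum_add_distrib, hc, Finset.sum_const,
      Finset.card_univ, Fintype.card_fin, nsmul_eq_mul, Finset.sum_ite_eq, Finset.mem_univ, if_true,
      ← Finset.mul_sum]
    ring
  have e3 : ∑ i, h i i ≤ ∑ i, ∑ j, h i j :=
    Finset.sum_le_sum fun i _ =>
      Finset.single_le_sum (f := fun j => h i j) (fun j _ => hpos i j) (Finset.mem_univ i)
  have hn' : (0 : ℝ) ≤ (n : ℝ) - 2 := by
    have : (2 : ℝ) ≤ n := by exact_mod_cast hn
    linarith
  have := mul_le_mul_of_nonneg_left e3 hn'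
  rw [e1]
  nlinarith

/-- Summing, over all choices of two labels per party, a function that is symmetric and vanishes on
the diagonal in the first two pairs of arguments. -/
theorem sum_three_orderEmb_le {a b c : ℕ} (hc : 2 ≤ c)
    (g : Fin a → Fin a → Fin b → Fin b → Fin c → Fin c → ℝ)
    (hpos : ∀ i i' j j' k k', 0 ≤ g i i' j j' k k')
    (hs1 : ∀ i i' j j' k k', g i i' j j' k k' = g i' i j j' k k')
    (hz1 : ∀ i j j' k k', g i i j j' k k' = 0)
    (hs2 : ∀ i i' j j' k k', g i i' j j' k k' = g i i' j' j k k')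
    (hz2 : ∀ i i' j k k', g i i' j j k k' = 0) :
    4 * ∑ f₁ : Fin 2 ↪o Fin a, ∑ f₂ : Fin 2 ↪o Fin b, ∑ f₃ : Fin 2 ↪o Fin c, ∑ k, ∑ l,
      g (f₁ 0) (f₁ 1) (f₂ 0) (f₂ 1) (f₃ k) (f₃ l) ≤
    ((c : ℝ) - 1) * ∑ i, ∑ i', ∑ j, ∑ j', ∑ k, ∑ k', g i i' j j' k k' := by
  have h3 : ∀ i i' j j', ∑ f₃ : Fin 2 ↪o Fin c, ∑ k, ∑ l, g i i' j j' (f₃ k) (f₃ l) ≤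
      ((c : ℝ) - 1) * ∑ k, ∑ k', g i i' j j' k k' := fun i i' j j' =>
    sum_orderEmb_block_le hc _ (hpos i i' j j')
  have h2 : ∀ i i', 2 * ∑ f₂ : Fin 2 ↪o Fin b, ∑ k, ∑ k', g i i' (f₂ 0) (f₂ 1) k k' =
      ∑ j, ∑ j', ∑ k, ∑ k', g i i' j j' k k' := fun i i' =>
    two_mul_sum_orderEmb (fun j j' => ∑ k, ∑ k', g i i' j j' k k')
      (fun j j' => by simp only [hs2 i i' j j']) (fun j => by simp [hz2])
  have h1 : 2 * ∑ f₁ : Fin 2 ↪o Fin a, ∑ j, ∑ j', ∑ k, ∑ k', g (f₁ 0) (f₁ 1) j j' k k' =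
      ∑ i, ∑ i', ∑ j, ∑ j', ∑ k, ∑ k', g i i' j j' k k' :=
    two_mul_sum_orderEmb (fun i i' => ∑ j, ∑ j', ∑ k, ∑ k', g i i' j j' k k')
      (fun i i' => by simp only [hs1 i i']) (fun i => by simp [hz1])
  calc _ ≤ 4 * ∑ f₁ : Fin 2 ↪o Fin a, ∑ f₂ : Fin 2 ↪o Fin b, ((c : ℝ) - 1) *
        ∑ k, ∑ k', g (f₁ 0) (f₁ 1) (f₂ 0) (f₂ 1) k k' := by gcongr; exact h3 _ _ _ _
    _ = ((c : ℝ) - 1) * (2 * ∑ f₁ : Fin 2 ↪o Fin a, 2 * ∑ f₂ : Fin 2 ↪o Fin b,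
        ∑ k, ∑ k', g (f₁ 0) (f₁ 1) (f₂ 0) (f₂ 1) k k') := by
      simp only [← Finset.mul_sum]; ring
    _ = _ := by rw [← h1]; simp only [h2]

end CountingPairs

/-! ### Label exchanges on two copies, and purities. -/

section Swap

variable {ι : Type} [DecidableEq ι] {d : ι → ℕ}

/-- The label that agrees with `y` on the parties in `α` and with `x` elsewhere. -/
def swapLabel (α : Finset ι) (x y : BasisIdx d) : BasisIdx d := fun i => if i ∈ α then y i else x i

/-- The product of the two amplitudes obtained by exchanging the labels `x`, `y` on `α`. -/
def swapProd (φ : BasisIdx d → ℂ) (α : Finset ι) (x y : BasisIdx d) : ℂ :=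
  φ (swapLabel α x y) * φ (swapLabel α y x)

theorem swapLabel_swapLabel (α β : Finset ι) (x y : BasisIdx d) :
    swapLabel α (swapLabel β x y) (swapLabel β y x) = swapLabel (symmDiff α β) x y := by
  funext i
  by_cases h1 : i ∈ α <;> by_cases h2 : i ∈ β <;> simp [swapLabel, Finset.mem_symmDiff, h1, h2]

theorem swapLabel_empty (x y : BasisIdx d) : swapLabel ∅ x y = x := by
  funext i; simp [swapLabel]

theorem swapProd_empty (φ : BasisIdx d → ℂ) (x y : BasisIdx d) :
    swapProd φ ∅ x y = φ x * φ y := by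
  simp [swapProd, swapLabel_empty]

theorem swapProd_swapLabel (φ : BasisIdx d → ℂ) (α β : Finset ι) (x y : BasisIdx d) :
    swapProd φ α (swapLabel β x y) (swapLabel β y x) = swapProd φ (symmDiff α β) x y := by
  simp [swapProd, swapLabel_swapLabel]

/-- Exchanging the labels on `α`. -/
def swapEquiv (α : Finset ι) : BasisIdx d × BasisIdx d ≃ BasisIdx d × BasisIdx d where
  toFun p := (swapLabel α p.1 p.2, swapLabel α p.2 p.1)
  invFun p := (swapLabel α p.1 p.2, swapLabel α p.2 p.1)
  left_inv p := by simp [swapLabel_swapLabel, swapLabel_empty]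
  right_inv p := by simp [swapLabel_swapLabel, swapLabel_empty]

variable [Fintype ι]

theorem swapLabel_compl (α : Finset ι) (x y : BasisIdx d) :
    swapLabel αᶜ x y = swapLabel α y x := by
  funext i; by_cases h : i ∈ α <;> simp [swapLabel, h]

theorem swapProd_compl (φ : BasisIdx d → ℂ) (α : Finset ι) (x y : BasisIdx d) :
    swapProd φ αᶜ x y = swapProd φ α x y := by
  simp [swapProd, swapLabel_compl, mul_comm]

/-- The purity `tr (ρ_α²)` of a reduced state of `φ`, as a sum over pairs of labels. -/
def purity (φ : BasisIdx d → ℂ) (α : Finset ι) : ℂ :=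
  ∑ p : BasisIdx d × BasisIdx d, swapProd φ ∅ p.1 p.2 * star (swapProd φ α p.1 p.2)

theorem purity_compl (φ : BasisIdx d → ℂ) (α : Finset ι) : purity φ αᶜ = purity φ α := by
  simp [purity, swapProd_compl]

/-- The exchange on α permutes the pairs of labels, so it can be moved onto the second factor. -/
theorem sum_swapProd_mul_star (φ : BasisIdx d → ℂ) (α β : Finset ι) :
    ∑ p : BasisIdx d × BasisIdx d, swapProd φ α p.1 p.2 * star (swapProd φ β p.1 p.2) =
      purity φ (symmDiff α β) := by
  rw [purity, ← (swapEquiv α).sum_comp]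
  refine Finset.sum_congr rfl fun p _ => ?_
  simp [swapEquiv, swapProd_swapLabel, symmDiff_comm]

theorem purity_empty (φ : PureVec d) : purity φ ∅ = (‖φ‖ : ℂ) ^ 4 := by
  have : ((‖φ‖ : ℂ)) ^ 2 = ∑ x, φ x * star (φ x) := by
    rw [← Complex.ofReal_pow, EuclideanSpace.norm_sq_eq]
    push_cast
    refine Finset.sum_congr rfl fun x _ => ?_
    simpa using (Complex.mul_conj' (φ x)).symm
  rw [show (4 : ℕ) = 2 * 2 from rfl, pow_mul, this, sq, Finset.sum_mul_sum,
    ← Fintype.sum_prod_type', purity]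
  refine Finset.sum_congr rfl fun p _ => ?_
  simp only [swapProd_empty, star_mul']
  ring

theorem sum_glue (α : Finset ι) (F : BasisIdx d → ℂ) :
    ∑ x, F x = ∑ x : BasisIdx (fun i : {i // i ∈ α} => d i),
      ∑ z : BasisIdx (fun i : {i // i ∉ α} => d i), F (glue α x z) := by
  rw [← Fintype.sum_prod_type',
    ← (Equiv.piEquivPiSubtypeProd (fun i => i ∈ α) (fun i => Fin (d i))).symm.sum_comp]
  rfl

omit [Fintype ι] in
theorem swapLabel_glue (α : Finset ι) (x y : BasisIdx (fun i : {i // i ∈ α} => d i))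
    (z w : BasisIdx (fun i : {i // i ∉ α} => d i)) :
    swapLabel α (glue α x z) (glue α y w) = glue α y z := by
  funext i; by_cases h : i ∈ α <;> simp [swapLabel, glue, h]

theorem trace_reducedState_ketbra_sq (φ : PureVec d) (α : Finset ι) :
    ((reducedState α (ketbra φ)) ^ 2).trace = purity φ α := by
  rw [purity, Fintype.sum_prod_type, sum_glue α]
  simp only [sum_glue α (fun y => swapProd _ _ _ y * _)]
  simp only [swapProd, swapLabel_empty, swapLabel_glue]
  simp only [sq, Matrix.trace, Matrix.diag, Matrix.mul_apply, reducedState, ketbra, Matrix.of_apply,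
    Finset.sum_mul_sum]
  refine Finset.sum_congr rfl fun x _ => ?_
  rw [Finset.sum_comm]
  refine Finset.sum_congr rfl fun z _ => ?_
  refine Finset.sum_congr rfl fun y _ => ?_
  refine Finset.sum_congr rfl fun w _ => ?_
  simp only [star_mul']
  ring

end Swap

/-! ### Norms of the antisymmetrized amplitudes. -/

section Inversion

variable {ι : Type} [DecidableEq ι] {d : ι → ℕ}

/-- The amplitudes of the universal spin flip on the parties in `α` and `β`. -/
def flipAmp (φ : BasisIdx d → ℂ) (α β : Finset ι) (x y : BasisIdx d) : ℂ :=
  swapProd φ ∅ x y + swapProd φ (symmDiff α β) x y - swapProd φ α x y - swapProd φ β x y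

variable [Fintype ι]

/-- The sixteen terms of the expanded square are purities of symmetric differences; each of the four
purities occurs four times. -/
theorem sum_norm_sq_flipAmp (φ : BasisIdx d → ℂ) (α β : Finset ι) :
    ((∑ p : BasisIdx d × BasisIdx d, ‖flipAmp φ α β p.1 p.2‖ ^ 2 : ℝ) : ℂ) =
      4 * (purity φ ∅ + purity φ (symmDiff α β) - purity φ α - purity φ β) := by
  have h1 : symmDiff (symmDiff α β) α = β := by rw [symmDiff_comm α β, symmDiff_symmDiff_cancel_right]
  have h2 : symmDiff (symmDiff α β) β = α := symmDiff_symmDiff_cancel_right β α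
  have h3 : symmDiff α (symmDiff α β) = β := symmDiff_symmDiff_cancel_left α β
  have h4 : symmDiff β (symmDiff α β) = α := by rw [symmDiff_comm, h2]
  have h0 : ∀ γ : Finset ι, symmDiff ∅ γ = γ := fun γ => bot_symmDiff γ
  have h0' : ∀ γ : Finset ι, symmDiff γ ∅ = γ := fun γ => symmDiff_bot γ
  have h5 : ∀ γ : Finset ι, symmDiff γ γ = ∅ := fun γ => symmDiff_self γ
  push_cast
  simp only [← Complex.mul_conj', flipAmp, map_add, map_sub, add_mul, mul_add, sub_mul, mul_sub,
    Finset.sum_add_distrib, Finset.sum_sub_distrib, starRingEnd_apply, sum_swapProd_mul_star,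
    h0, h0', h1, h2, h3, h4, h5, symmDiff_comm β α]
  ring

theorem sum_norm_sq_swapProd_sub (φ : BasisIdx d → ℂ) (α : Finset ι) :
    ((∑ p : BasisIdx d × BasisIdx d, ‖swapProd φ ∅ p.1 p.2 - swapProd φ α p.1 p.2‖ ^ 2 : ℝ) : ℂ) =
      2 * (purity φ ∅ - purity φ α) := by
  have h0 : ∀ γ : Finset ι, symmDiff ∅ γ = γ := fun γ => bot_symmDiff γ
  have h0' : ∀ γ : Finset ι, symmDiff γ ∅ = γ := fun γ => symmDiff_bot γ
  have h5 : ∀ γ : Finset ι, symmDiff γ γ = ∅ := fun γ => symmDiff_self γ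
  push_cast
  simp only [← Complex.mul_conj', map_sub, sub_mul, mul_sub,
    Finset.sum_sub_distrib, starRingEnd_apply, sum_swapProd_mul_star, h0, h0', h5]
  ring

end Inversion

/-! ### The three-party concurrence of a pure state. -/

theorem pureConcurrence_nonneg {ι : Type} [Fintype ι] [DecidableEq ι] {d : ι → ℕ} (φ : PureVec d) :
    0 ≤ pureConcurrence φ := by
  unfold pureConcurrence
  positivity

theorem pureConcurrence_three {d : Fin 3 → ℕ} (φ : PureVec d) (hφ : ‖φ‖ = 1) :
    4 * pureConcurrence φ ^ 2 =
      ∑ p : BasisIdx d × BasisIdx d, ‖flipAmp φ {0} {1} p.1 p.2‖ ^ 2 +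
      ∑ p : BasisIdx d × BasisIdx d, ‖flipAmp φ {0} {2} p.1 p.2‖ ^ 2 +
      ∑ p : BasisIdx d × BasisIdx d, ‖flipAmp φ {1} {2} p.1 p.2‖ ^ 2 := by
  have hre : ∀ α β : Finset (Fin 3),
      ∑ p : BasisIdx d × BasisIdx d, ‖flipAmp φ α β p.1 p.2‖ ^ 2 =
      4 * (1 + (purity φ (symmDiff α β)).re - (purity φ α).re - (purity φ β).re) := fun α β => by
    have := congrArg Complex.re (sum_norm_sq_flipAmp φ α β)
    rw [Complex.ofReal_re, purity_empty, hφ] at this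
    simpa using this
  have hnn : ∀ α β : Finset (Fin 3),
      0 ≤ ∑ p : BasisIdx d × BasisIdx d, ‖flipAmp φ α β p.1 p.2‖ ^ 2 := fun α β => by positivity
  have f : (Finset.univ.filter fun α : Finset (Fin 3) => α.Nonempty ∧ α ≠ Finset.univ) =
      {{0}, {1}, {2}, {0}ᶜ, {1}ᶜ, {2}ᶜ} := by decide
  have s01 : symmDiff ({0} : Finset (Fin 3)) {1} = {2}ᶜ := by decide
  have s02 : symmDiff ({0} : Finset (Fin 3)) {2} = {1}ᶜ := by decide
  have s12 : symmDiff ({1} : Finset (Fin 3)) {2} = {0}ᶜ := by decide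
  -- These three bounds add up to the nonnegativity of the radicand, needed to square the root.
  have n01 := hnn {0} {1}
  have n02 := hnn {0} {2}
  have n12 := hnn {1} {2}
  rw [hre, s01, purity_compl] at n01
  rw [hre, s02, purity_compl] at n02
  rw [hre, s12, purity_compl] at n12
  rw [hre, hre, hre, s01, s02, s12]
  simp only [purity_compl]
  have hsum : ∑ α : Finset (Fin 3) with α.Nonempty ∧ α ≠ Finset.univ,
        ((reducedState α (ketbra φ) ^ 2).trace).re =
      2 * ((purity φ {0}).re + (purity φ {1}).re + (purity φ {2}).re) := by
    simp only [trace_reducedState_ketbra_sq]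
    rw [f, Finset.sum_insert (by decide), Finset.sum_insert (by decide),
      Finset.sum_insert (by decide), Finset.sum_insert (by decide), Finset.sum_insert (by decide),
      Finset.sum_singleton]
    simp only [purity_compl]
    ring
  unfold pureConcurrence
  rw [hsum, mul_pow, Real.sq_sqrt (by simp only [Fintype.card_fin]; linarith),
    ← Real.rpow_natCast, ← Real.rpow_mul (by norm_num)]
  have : (1 - (Fintype.card (Fin 3) : ℝ) / 2) * (2 : ℕ) = -1 := by
    simp only [Fintype.card_fin]; norm_num
  rw [this, Real.rpow_neg_one]
  simp only [Fintype.card_fin]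
  ring

/-! ### The two-qubit concurrence of a pure state as a spin-flip form. -/

section TwoQubits

variable {ι : Type} [DecidableEq ι]

/-- The two-qubit label with entry `s` at the party `a` and `t` elsewhere. -/
def pairLabel (a : ι) (s t : Fin 2) : BasisIdx (fun _ : ι => 2) := fun i => if i = a then s else t

/-- The spin-flip bilinear form of two-qubit vectors. -/
def spinForm (a : ι) (v w : BasisIdx (fun _ : ι => 2) → ℂ) : ℂ :=
  v (pairLabel a 0 0) * w (pairLabel a 1 1) + v (pairLabel a 1 1) * w (pairLabel a 0 0)
    - v (pairLabel a 0 1) * w (pairLabel a 1 0) - v (pairLabel a 1 0) * w (pairLabel a 0 1)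

variable [Fintype ι]

theorem sum_pairLabel {M : Type*} [AddCommMonoid M] {a b : ι} (hab : a ≠ b)
    (hu : ∀ i, i = a ∨ i = b) (F : BasisIdx (fun _ : ι => 2) → M) :
    ∑ x, F x = ∑ s, ∑ t, F (pairLabel a s t) := by
  rw [← Fintype.sum_prod_type']
  refine (Fintype.sum_equiv ⟨fun p => pairLabel a p.1 p.2, fun x => (x a, x b), ?_, ?_⟩ _ _ ?_).symm
  · intro p
    simp [pairLabel, hab.symm]
  · intro x
    funext i
    rcases hu i with rfl | rfl
    · simp [pairLabel]
    · simp [pairLabel, hab.symm]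
  · intro p
    rfl

theorem pureConcurrence_two_qubits {a b : ι} (hab : a ≠ b) (hu : ∀ i, i = a ∨ i = b)
    (φ : PureVec (fun _ : ι => 2)) (hφ : ‖φ‖ = 1) :
    pureConcurrence φ = ‖spinForm a φ φ‖ := by
  have huniv : (Finset.univ : Finset ι) = {a, b} := by
    ext i; simpa using hu i
  have hcard : Fintype.card ι = 2 := by
    rw [← Finset.card_univ, huniv, Finset.card_pair hab]
  have hc : ({b} : Finset ι) = {a}ᶜ := by
    ext i
    rcases hu i with rfl | rfl
    · simp [hab]
    · simp [hab.symm]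
  have f : (Finset.univ.filter fun α : Finset ι => α.Nonempty ∧ α ≠ Finset.univ) = {{a}, {b}} := by
    ext α
    simp only [Finset.mem_filter, Finset.mem_univ, true_and, Finset.mem_insert,
      Finset.mem_singleton]
    constructor
    · rintro ⟨h1, h2⟩
      have hsub : α = ∅ ∨ α = {a} ∨ α = {b} ∨ α = {a, b} := by
        have hext : ∀ β : Finset ι, (a ∈ α ↔ a ∈ β) → (b ∈ α ↔ b ∈ β) → α = β := by
          intro β ha hb
          ext i
          rcases hu i with rfl | rfl
          exacts [ha, hb]
        by_cases ha : a ∈ α <;> by_cases hb : b ∈ α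
        · exact Or.inr (Or.inr (Or.inr (hext _ (by simp [ha]) (by simp [hb]))))
        · exact Or.inr (Or.inl (hext _ (by simp [ha]) (by simp [hb, hab.symm])))
        · exact Or.inr (Or.inr (Or.inl (hext _ (by simp [ha, hab]) (by simp [hb]))))
        · exact Or.inl (hext _ (by simp [ha]) (by simp [hb]))
      rcases hsub with h | h | h | h
      · exact absurd h h1.ne_empty
      · exact Or.inl h
      · exact Or.inr h
      · exact absurd (h.trans huniv.symm) h2
    · rintro (rfl | rfl)
      · refine ⟨Finset.singleton_nonempty _, fun h => ?_⟩
        have := h ▸ Finset.mem_univ b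
        exact hab (Finset.mem_singleton.1 this).symm
      · refine ⟨Finset.singleton_nonempty _, fun h => ?_⟩
        have := h ▸ Finset.mem_univ a
        exact hab (Finset.mem_singleton.1 this)
  have hsum : ∑ α : Finset ι with α.Nonempty ∧ α ≠ Finset.univ,
        ((reducedState α (ketbra φ) ^ 2).trace).re = 2 * (purity φ {a}).re := by
    simp only [trace_reducedState_ketbra_sq]
    rw [f, Finset.sum_pair (by simpa using hab), hc, purity_compl]
    ring
  have hre := congrArg Complex.re (sum_norm_sq_swapProd_sub φ {a})
  rw [Complex.ofReal_re, purity_empty, hφ] at hre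
  simp only [Complex.ofReal_one, one_pow, Complex.mul_re, Complex.sub_re, Complex.one_re,
    Complex.re_ofNat, Complex.im_ofNat, zero_mul, sub_zero] at hre
  have hsw : ∀ s t s' t', swapLabel {a} (pairLabel a s t) (pairLabel a s' t') = pairLabel a s' t := by
    intro s t s' t'
    funext i
    rcases hu i with rfl | rfl
    · simp [swapLabel, pairLabel]
    · simp [swapLabel, pairLabel, hab.symm]
  -- Only the four ordered pairs of labels that differ at both qubits contribute. Each gives ± the
  -- determinant D, and 4|D|² = |2D|².
  have key : ∑ p : BasisIdx (fun _ : ι => 2) × BasisIdx (fun _ : ι => 2),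
      ‖swapProd φ ∅ p.1 p.2 - swapProd φ {a} p.1 p.2‖ ^ 2 = ‖spinForm a φ φ‖ ^ 2 := by
    set D := φ (pairLabel a 0 0) * φ (pairLabel a 1 1) - φ (pairLabel a 0 1) * φ (pairLabel a 1 0)
      with hD
    have hS : spinForm a φ φ = 2 * D := by rw [hD, spinForm]; ring
    have hpair : ∀ G : BasisIdx (fun _ : ι => 2) → BasisIdx (fun _ : ι => 2) → ℝ,
        ∑ p : BasisIdx (fun _ : ι => 2) × BasisIdx (fun _ : ι => 2), G p.1 p.2 =
          ∑ s, ∑ t, ∑ s', ∑ t', G (pairLabel a s t) (pairLabel a s' t') := fun G => by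
      rw [Fintype.sum_prod_type, sum_pairLabel hab hu]
      simp only [sum_pairLabel hab hu]
    rw [hpair fun x y => ‖swapProd φ ∅ x y - swapProd φ {a} x y‖ ^ 2]
    simp only [Fin.sum_univ_two, swapProd, swapLabel_empty, hsw]
    have e1 : φ (pairLabel a 0 1) * φ (pairLabel a 1 0) -
        φ (pairLabel a 1 1) * φ (pairLabel a 0 0) = - D := by rw [hD]; ring
    have e2 : φ (pairLabel a 1 0) * φ (pairLabel a 0 1) -
        φ (pairLabel a 0 0) * φ (pairLabel a 1 1) = - D := by rw [hD]; ring
    have e3 : φ (pairLabel a 1 1) * φ (pairLabel a 0 0) -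
        φ (pairLabel a 0 1) * φ (pairLabel a 1 0) = D := by rw [hD]; ring
    have e0 : φ (pairLabel a 0 0) * φ (pairLabel a 1 1) -
        φ (pairLabel a 1 0) * φ (pairLabel a 0 1) = D := by rw [hD]; ring
    have e4 : ∀ u v : ℂ, ‖u * v - v * u‖ ^ 2 = 0 := fun u v => by simp [mul_comm]
    simp only [e0, e1, e2, e3, e4, sub_self, norm_zero, norm_neg, hS, norm_mul]
    norm_num
    ring
  unfold pureConcurrence
  rw [hsum, hcard, ← Real.sqrt_sq (norm_nonneg (spinForm a φ φ)), ← key, hre]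
  rw [show (1 : ℝ) - (2 : ℕ) / 2 = 0 by norm_num, Real.rpow_zero, one_mul]
  congr 1
  ring

end TwoQubits

/-! ### Mixing two vectors so that one becomes isotropic. -/

section Isotropic

theorem exists_isotropic_unit (A B C : ℂ) :
    ∃ u v : ℂ, ‖u‖ ^ 2 + ‖v‖ ^ 2 = 1 ∧ u ^ 2 * A + 2 * (u * v) * B + v ^ 2 * C = 0 := by
  by_cases hA : A = 0
  · exact ⟨1, 0, by simp, by simp [hA]⟩
  obtain ⟨s, hs⟩ := IsAlgClosed.exists_eq_mul_self (discrim A (2 * B) C)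
  obtain ⟨z, hz⟩ := exists_quadratic_eq_zero hA ⟨s, hs⟩
  have hpos : 0 < ‖z‖ ^ 2 + 1 := by positivity
  have hr : (√(‖z‖ ^ 2 + 1))⁻¹ ^ 2 * (‖z‖ ^ 2 + 1) = 1 := by
    rw [inv_pow, Real.sq_sqrt hpos.le, inv_mul_cancel₀ hpos.ne']
  set r : ℝ := (√(‖z‖ ^ 2 + 1))⁻¹
  -- The vector (z, 1), with z a root of A z² + 2 B z + C, scaled to unit length.
  refine ⟨r * z, r, ?_, ?_⟩
  · rw [norm_mul, Complex.norm_real, mul_pow, Real.norm_eq_abs, sq_abs]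
    linarith
  · linear_combination (r : ℂ) ^ 2 * hz

/-- Cauchy–Schwarz for (u², √2 uv, v²) and (A, √2 B, C); the first vector has norm |u|² + |v|². -/
theorem norm_quadratic_le (A B C u v : ℂ) (huv : ‖u‖ ^ 2 + ‖v‖ ^ 2 = 1) :
    ‖u ^ 2 * A + 2 * (u * v) * B + v ^ 2 * C‖ ^ 2 ≤ ‖A‖ ^ 2 + 2 * ‖B‖ ^ 2 + ‖C‖ ^ 2 := by
  have h1 : ‖u ^ 2 * A + 2 * (u * v) * B + v ^ 2 * C‖ ≤
      ‖u‖ ^ 2 * ‖A‖ + 2 * (‖u‖ * ‖v‖) * ‖B‖ + ‖v‖ ^ 2 * ‖C‖ := by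
    refine (norm_add₃_le).trans_eq ?_
    simp
  have h2 : (‖u‖ ^ 2 * ‖A‖ + 2 * (‖u‖ * ‖v‖) * ‖B‖ + ‖v‖ ^ 2 * ‖C‖) ^ 2 ≤
      (‖u‖ ^ 2 + ‖v‖ ^ 2) ^ 2 * (‖A‖ ^ 2 + 2 * ‖B‖ ^ 2 + ‖C‖ ^ 2) := by
    nlinarith [sq_nonneg (‖u‖ ^ 2 * ‖B‖ - ‖u‖ * ‖v‖ * ‖A‖), sq_nonneg (‖u‖ ^ 2 * ‖C‖ - ‖v‖ ^ 2 * ‖A‖),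
      sq_nonneg (‖u‖ * ‖v‖ * ‖C‖ - ‖v‖ ^ 2 * ‖B‖)]
  rw [huv, one_pow, one_mul] at h2
  exact (pow_le_pow_left₀ (norm_nonneg _) h1 2).trans h2

variable {ι : Type} [DecidableEq ι] [Fintype ι]

theorem exists_ketbra_add_isotropic (a : ι) (v : Fin 2 → PureVec (fun _ : ι => 2)) :
    ∃ w : Fin 2 → PureVec (fun _ : ι => 2),
      ∑ k, ketbra (v k) = ∑ k, ketbra (w k) ∧ spinForm a (w 0) (w 0) = 0 ∧
      ‖spinForm a (w 1) (w 1)‖ ≤ √(∑ k, ∑ l, ‖spinForm a (v k) (v l)‖ ^ 2) := by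
  obtain ⟨x, y, hxy, h0⟩ := exists_isotropic_unit (spinForm a (v 0) (v 0)) (spinForm a (v 0) (v 1))
    (spinForm a (v 1) (v 1))
  have hxy' : x * star x + y * star y = 1 := by
    have := congrArg (fun r : ℝ => (r : ℂ)) hxy
    simpa [← Complex.mul_conj'] using this
  have hbil : ∀ s t : ℂ, spinForm a (s • v 0 + t • v 1 : PureVec _) (s • v 0 + t • v 1 : PureVec _) =
      s ^ 2 * spinForm a (v 0) (v 0) + 2 * (s * t) * spinForm a (v 0) (v 1) +
        t ^ 2 * spinForm a (v 1) (v 1) := by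
    intro s t
    simp only [spinForm, PiLp.add_apply, PiLp.smul_apply, smul_eq_mul]
    ring
  have hsymm : spinForm a (v 1) (v 0) = spinForm a (v 0) (v 1) := by
    simp only [spinForm]; ring
  -- The second row completes (x, y) to a unitary matrix, which preserves the sum of the rank-one
  -- operators.
  refine ⟨![x • v 0 + y • v 1, (-star y) • v 0 + (star x) • v 1], ?_, ?_, ?_⟩
  · ext p q
    simp only [Fin.sum_univ_two, Matrix.cons_val_zero, Matrix.cons_val_one, Matrix.add_apply, ketbra,
      Matrix.of_apply, PiLp.add_apply, PiLp.smul_apply, smul_eq_mul, star_add, star_mul', star_neg,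
      star_star]
    linear_combination (-(v 0 p * star (v 0 q) + v 1 p * star (v 1 q))) * hxy'
  · exact (hbil x y).trans h0
  · refine Real.le_sqrt_of_sq_le ?_
    change ‖spinForm a ((-star y) • v 0 + star x • v 1 : PureVec _)
      ((-star y) • v 0 + star x • v 1 : PureVec _)‖ ^ 2 ≤ _
    rw [hbil]
    refine (norm_quadratic_le _ _ _ _ _ ?_).trans_eq ?_
    swap
    · simp only [Fin.sum_univ_two, hsymm]; ring
    simpa [add_comm] using hxy

end Isotropic

/-! ### The convex roof: upper bounds and existence of ensembles. -/

section ConvexRoof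

variable {ι : Type} [Fintype ι] [DecidableEq ι] {d : ι → ℕ}

theorem concurrence_le_sum {J : Type*} [Fintype J] (σ : Op d) (r : J → ℝ) (ψ : J → PureVec d)
    (hr : ∀ j, 0 ≤ r j) (hψ : ∀ j, ‖ψ j‖ = 1) (hσ : σ = ∑ j, (r j : ℂ) • ketbra (ψ j)) :
    concurrence σ ≤ ∑ j, r j * pureConcurrence (ψ j) := by
  refine csInf_le ⟨0, ?_⟩ ?_
  · rintro c ⟨n, p, φ, hp, -, -, rfl⟩
    exact Finset.sum_nonneg fun k _ => mul_nonneg (hp k) (pureConcurrence_nonneg _)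
  · let e := Fintype.equivFin J
    refine ⟨Fintype.card J, r ∘ e.symm, ψ ∘ e.symm, fun k => hr _, fun k => hψ _, ?_, ?_⟩
    · rw [hσ]
      exact (e.symm.sum_comp fun j => (r j : ℂ) • ketbra (ψ j)).symm
    · exact (e.symm.sum_comp fun j => r j * pureConcurrence (ψ j)).symm

theorem concurrence_nonneg (σ : Op d) : 0 ≤ concurrence σ := by
  refine Real.sInf_nonneg ?_
  rintro c ⟨n, p, φ, hp, -, -, rfl⟩
  exact Finset.sum_nonneg fun k _ => mul_nonneg (hp k) (pureConcurrence_nonneg _)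

theorem exists_unit_smul [Nonempty (BasisIdx d)] (w : PureVec d) :
    ∃ ψ : PureVec d, ‖ψ‖ = 1 ∧ w = (‖w‖ : ℂ) • ψ := by
  by_cases hw : w = 0
  · obtain ⟨x⟩ := ‹Nonempty (BasisIdx d)›
    exact ⟨EuclideanSpace.single x 1, by simp, by simp [hw]⟩
  · have h : (‖w‖ : ℂ) ≠ 0 := by simpa using hw
    refine ⟨(‖w‖ : ℂ)⁻¹ • w, ?_, ?_⟩
    · rw [norm_smul, norm_inv, Complex.norm_real, norm_norm, inv_mul_cancel₀ (norm_ne_zero_iff.2 hw)]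
    · rw [smul_smul, mul_inv_cancel₀ h, one_smul]

theorem ketbra_smul (c : ℝ) (ψ : PureVec d) :
    ketbra ((c : ℂ) • ψ) = ((c ^ 2 : ℝ) : ℂ) • ketbra ψ := by
  ext x y
  simp [ketbra]
  ring

open scoped MatrixOrder in
-- Writing ρ = B* B, the conjugated rows of B form an ensemble after normalization. Nonemptiness
-- matters because `sInf ∅ = 0` in ℝ.
theorem ensembleAverages_nonempty [Nonempty (BasisIdx d)] {ρ : Op d} (hρ : ρ.PosSemidef) :
    (ensembleAverages ρ).Nonempty := by
  obtain ⟨B, hB⟩ := CStarAlgebra.nonneg_iff_eq_star_mul_self.1 hρ.nonneg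
  choose ψ hψ hw using fun j => exists_unit_smul (WithLp.toLp 2 fun x => star (B j x) : PureVec d)
  let e := Fintype.equivFin (BasisIdx d)
  refine ⟨_, Fintype.card (BasisIdx d),
    fun k => ‖(WithLp.toLp 2 fun x => star (B (e.symm k) x) : PureVec d)‖ ^ 2, fun k => ψ (e.symm k),
    fun k => by positivity, fun k => hψ _, ?_, rfl⟩
  simp only [← ketbra_smul, ← hw]
  rw [e.symm.sum_comp fun j => ketbra (WithLp.toLp 2 fun x => star (B j x) : PureVec d), hB]
  ext x y
  simp [Matrix.star_eq_conjTranspose, Matrix.mul_apply, Matrix.sum_apply, ketbra]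

end ConvexRoof

/-! ### Two-qubit matrices given by two vectors. -/

section ReducedTwoQubits

variable {ι : Type} [Fintype ι] [DecidableEq ι]

theorem exists_ensemble_two_qubits {a b : ι} (hab : a ≠ b) (hu : ∀ i, i = a ∨ i = b)
    (v : Fin 2 → PureVec (fun _ : ι => 2)) :
    ∃ (r : Fin 2 → ℝ) (ψ : Fin 2 → PureVec (fun _ : ι => 2)), (∀ j, 0 ≤ r j) ∧ (∀ j, ‖ψ j‖ = 1) ∧
      ∑ k, ketbra (v k) = ∑ j, (r j : ℂ) • ketbra (ψ j) ∧
      ∑ j, r j * pureConcurrence (ψ j) ≤ √(∑ k, ∑ l, ‖spinForm a (v k) (v l)‖ ^ 2) := by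
  obtain ⟨w, hvw, h0, h1⟩ := exists_ketbra_add_isotropic a v
  choose ψ hψ hw using fun j => exists_unit_smul (w j)
  have hC : ∀ j, ‖w j‖ ^ 2 * pureConcurrence (ψ j) = ‖spinForm a (w j) (w j)‖ := by
    intro j
    rw [pureConcurrence_two_qubits hab hu _ (hψ j)]
    nth_rw 2 3 [hw j]
    have : spinForm a ((‖w j‖ : ℂ) • ψ j : PureVec _) ((‖w j‖ : ℂ) • ψ j : PureVec _) =
        (‖w j‖ : ℂ) ^ 2 * spinForm a (ψ j) (ψ j) := by
      simp only [spinForm, PiLp.smul_apply, smul_eq_mul]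
      ring
    rw [this, norm_mul, norm_pow, Complex.norm_real, norm_norm]
  refine ⟨fun j => ‖w j‖ ^ 2, ψ, fun j => by positivity, hψ, ?_, ?_⟩
  · simp only [← ketbra_smul, ← hw, hvw]
  · simpa [hC, Fin.sum_univ_two, h0] using h1

end ReducedTwoQubits

/-! ### Reduced substates of an ensemble. -/

section Substates

variable {d : Fin 3 → ℕ}

/-- The label of the corner of a substate with the entries `s`, `t` at `m`, `n` and `k` at the
remaining party. -/
def cornerLabel (f : QubitChoice d) (m n : Fin 3) (s t k : Fin 2) : BasisIdx d :=
  fun i => f i (if i = m then s else if i = n then t else k)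

theorem concurrence_reducedState_qubitSubstate_le {m n p : Fin 3} (hmn : m ≠ n) (hmp : m ≠ p)
    (hnp : n ≠ p) (f : QubitChoice d) {N : ℕ} (q : Fin N → ℝ) (hq : ∀ k, 0 ≤ q k)
    (φ : Fin N → PureVec d) :
    concurrence (reducedState {m, n} (qubitSubstate (∑ k, (q k : ℂ) • ketbra (φ k)) f)) ≤
      ∑ k, q k * √(∑ s, ∑ t, ‖flipAmp (φ k) {m} {n} (cornerLabel f m n 0 0 s)
        (cornerLabel f m n 1 1 t)‖ ^ 2) := by
  let a : {i // i ∈ ({m, n} : Finset (Fin 3))} := ⟨m, by simp⟩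
  let b : {i // i ∈ ({m, n} : Finset (Fin 3))} := ⟨n, by simp⟩
  have hab : a ≠ b := fun h => hmn (congrArg Subtype.val h)
  have hu : ∀ i, i = a ∨ i = b := by
    rintro ⟨i, hi⟩
    simpa [a, b] using hi
  have hout : ∀ i, i ∉ ({m, n} : Finset (Fin 3)) ↔ i = p := by
    revert m n p; decide
  -- Only the party p is traced out, so each partial trace has just two terms, one for each slice.
  let _ : Unique {i // i ∉ ({m, n} : Finset (Fin 3))} :=
    { default := ⟨p, (hout p).2 rfl⟩
      uniq := fun i => Subtype.ext ((hout i).1 i.2) }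
  let v : Fin N → Fin 2 → PureVec (fun _ : {i // i ∈ ({m, n} : Finset (Fin 3))} => 2) := fun k z =>
    WithLp.toLp 2 fun x => φ k fun i => f i (glue (d := fun _ => 2) {m, n} x (fun _ => z) i)
  have hdec : reducedState {m, n} (qubitSubstate (∑ k, (q k : ℂ) • ketbra (φ k)) f) =
      ∑ k, (q k : ℂ) • ∑ z, ketbra (v k z) := by
    ext x y
    simp only [reducedState, qubitSubstate, Matrix.of_apply, Matrix.submatrix_apply, Matrix.sum_apply,
      Matrix.smul_apply, smul_eq_mul]
    rw [Finset.sum_comm]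
    refine Finset.sum_congr rfl fun k _ => ?_
    rw [← Finset.mul_sum,
      ← (Equiv.funUnique {i // i ∉ ({m, n} : Finset (Fin 3))} (Fin 2)).symm.sum_comp]
    rfl
  have hglue : ∀ s t z, (fun i => f i (glue (d := fun _ => 2) {m, n} (pairLabel a s t)
      (fun _ => z) i)) = cornerLabel f m n s t z := by
    intro s t z
    funext i
    simp only [cornerLabel]
    congr 1
    by_cases h1 : i = m
    · subst h1; simp [glue, pairLabel, a]
    · by_cases h2 : i = n
      · subst h2; simp [glue, pairLabel, a, h1]
      · simp [glue, h1, h2]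
  have hsw : ∀ (α : Finset (Fin 3)) (s t k s' t' k'), p ∉ α →
      swapLabel α (cornerLabel f m n s t k) (cornerLabel f m n s' t' k') =
        cornerLabel f m n (if m ∈ α then s' else s) (if n ∈ α then t' else t) k := by
    intro α s t k s' t' k' hp
    funext i
    by_cases h1 : i = m
    · subst h1; by_cases h : i ∈ α <;> simp [swapLabel, cornerLabel, h]
    · by_cases h2 : i = n
      · subst h2; by_cases h : i ∈ α <;> simp [swapLabel, cornerLabel, h, h1]
      · have : i = p := (hout i).1 (by simp [h1, h2])
        subst this
        simp [swapLabel, cornerLabel, h1, h2, hp]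
  -- Neither {m}, {n} nor their symmetric difference contains p, so the exchanges keep the slice
  -- labels s, t fixed and act on the two-qubit labels only.
  have hform : ∀ k s t, spinForm a (v k s) (v k t) =
      flipAmp (φ k) {m} {n} (cornerLabel f m n 0 0 s) (cornerLabel f m n 1 1 t) := by
    intro k s t
    have hS : p ∉ symmDiff ({m} : Finset (Fin 3)) {n} := by
      simp [Finset.mem_symmDiff, hmp.symm, hnp.symm]
    simp only [spinForm, flipAmp, swapProd, v, hglue, hsw ∅ _ _ _ _ _ _ (Finset.notMem_empty p),
      hsw {m} _ _ _ _ _ _ (by simpa using hmp.symm), hsw {n} _ _ _ _ _ _ (by simpa using hnp.symm),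
      hsw _ _ _ _ _ _ _ hS, Finset.mem_symmDiff, Finset.mem_singleton, Finset.notMem_empty, hmn,
      hmn.symm, if_true, if_false, not_false_eq_true, not_true_eq_false, and_true, and_false,
      or_true, or_false]
    ring
  choose r ψ hr hψ hrψ hC using fun k => exists_ensemble_two_qubits hab hu (v k)
  refine (concurrence_le_sum (J := Fin N × Fin 2) _ (fun j => q j.1 * r j.1 j.2) (fun j => ψ j.1 j.2)
    (fun j => mul_nonneg (hq _) (hr _ _)) (fun j => hψ _ _) ?_).trans ?_
  · rw [hdec, Fintype.sum_prod_type]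
    refine Finset.sum_congr rfl fun k _ => ?_
    rw [hrψ k, Finset.smul_sum]
    refine Finset.sum_congr rfl fun j _ => ?_
    rw [smul_smul, Complex.ofReal_mul]
  · rw [Fintype.sum_prod_type]
    refine Finset.sum_le_sum fun k _ => ?_
    simp only [mul_assoc, ← Finset.mul_sum]
    refine mul_le_mul_of_nonneg_left ?_ (hq k)
    simpa only [hform] using hC k

end Substates

/-! ### Antisymmetry of the spin-flip amplitudes. -/

section FlipSymmetry

variable {ι : Type} [DecidableEq ι] {d : ι → ℕ}

/-- This is S_α (1 - S_α) = -(1 - S_α). -/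
theorem flipAmp_swapLabel_left (φ : BasisIdx d → ℂ) (α β : Finset ι) (x y : BasisIdx d) :
    flipAmp φ α β (swapLabel α x y) (swapLabel α y x) = -flipAmp φ α β x y := by
  have h1 : symmDiff (symmDiff α β) α = β := by rw [symmDiff_comm α β, symmDiff_symmDiff_cancel_right]
  have h0 : symmDiff ∅ α = α := bot_symmDiff α
  have h5 : symmDiff α α = ∅ := symmDiff_self α
  simp only [flipAmp, swapProd_swapLabel, h0, h1, h5, symmDiff_comm β α]
  ring

theorem flipAmp_comm (φ : BasisIdx d → ℂ) (α β : Finset ι) (x y : BasisIdx d) :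
    flipAmp φ α β x y = flipAmp φ β α x y := by
  simp only [flipAmp, symmDiff_comm β α]
  ring

/-- Exchanging equal labels changes nothing, so the value is its own negative. -/
theorem flipAmp_eq_zero_left (φ : BasisIdx d → ℂ) {a : ι} (β : Finset ι) {x y : BasisIdx d}
    (h : x a = y a) : flipAmp φ {a} β x y = 0 := by
  have hx : ∀ x y : BasisIdx d, x a = y a → swapLabel {a} x y = x := by
    intro x y h
    funext i
    by_cases hi : i = a
    · subst hi; simp [swapLabel, h]
    · simp [swapLabel, hi]
  have := flipAmp_swapLabel_left φ {a} β x y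
  rw [hx x y h, hx y x h.symm] at this
  exact self_eq_neg.1 this

end FlipSymmetry

/-! ### Summing over all substates. -/

section Counting

/-- Coordinates of a triple, listed in a chosen order. -/
noncomputable def tripleEquiv (X : Fin 3 → Type) {m n p : Fin 3} (hmn : m ≠ n) (hmp : m ≠ p) (hnp : n ≠ p) :
    (∀ i, X i) ≃ X m × X n × X p :=
  Equiv.ofBijective (fun x => (x m, x n, x p)) <| by
    have hall : ∀ i, i = m ∨ i = n ∨ i = p := by revert m n p; decide
    constructor
    · intro x y hxy
      simp only [Prod.mk.injEq] at hxy
      funext i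
      rcases hall i with rfl | rfl | rfl
      exacts [hxy.1, hxy.2.1, hxy.2.2]
    · rintro ⟨a, b, c⟩
      have : ∀ i, ∃ y : X i, (∀ h : m = i, y = h ▸ a) ∧ (∀ h : n = i, y = h ▸ b) ∧
          (∀ h : p = i, y = h ▸ c) := by
        intro i
        rcases hall i with rfl | rfl | rfl
        · exact ⟨a, fun _ => rfl, fun h => absurd h hmn.symm, fun h => absurd h hmp.symm⟩
        · exact ⟨b, fun h => absurd h hmn, fun _ => rfl, fun h => absurd h hnp.symm⟩
        · exact ⟨c, fun h => absurd h hmp, fun h => absurd h hnp, fun _ => rfl⟩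
      choose y hy using this
      exact ⟨y, Prod.ext ((hy m).1 rfl) (Prod.ext ((hy n).2.1 rfl) ((hy p).2.2 rfl))⟩

variable {d : Fin 3 → ℕ}

/-- The 4 counts the orderings of the label pairs at m and n, which change only the sign; d p - 1
counts the choices at p that contain a repeated label. -/
theorem sum_substates_flipAmp_le {m n p : Fin 3} (hmn : m ≠ n) (hmp : m ≠ p) (hnp : n ≠ p)
    (hd : 2 ≤ d p) (φ : BasisIdx d → ℂ) :
    4 * ∑ f : QubitChoice d, ∑ s, ∑ t,
      ‖flipAmp φ {m} {n} (cornerLabel f m n 0 0 s) (cornerLabel f m n 1 1 t)‖ ^ 2 ≤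
    ((d p : ℝ) - 1) * ∑ q : BasisIdx d × BasisIdx d, ‖flipAmp φ {m} {n} q.1 q.2‖ ^ 2 := by
  let E := tripleEquiv (fun i => Fin (d i)) hmn hmp hnp
  have hE : ∀ x, E x = (x m, x n, x p) := fun x => rfl
  have hEm : ∀ a b c, E.symm (a, b, c) m = a := fun a b c =>
    congrArg Prod.fst (E.apply_symm_apply (a, b, c))
  have hEn : ∀ a b c, E.symm (a, b, c) n = b := fun a b c =>
    congrArg (fun z => z.2.1) (E.apply_symm_apply (a, b, c))
  have hEp : ∀ a b c, E.symm (a, b, c) p = c := fun a b c =>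
    congrArg (fun z => z.2.2) (E.apply_symm_apply (a, b, c))
  have hsm : ∀ a b c a' b' c', swapLabel {m} (E.symm (a, b, c)) (E.symm (a', b', c')) =
      E.symm (a', b, c) := by
    intro a b c a' b' c'
    rw [Equiv.eq_symm_apply, hE]
    simp [swapLabel, hmn.symm, hmp.symm, hEm, hEn, hEp]
  have hsn : ∀ a b c a' b' c', swapLabel {n} (E.symm (a, b, c)) (E.symm (a', b', c')) =
      E.symm (a, b', c) := by
    intro a b c a' b' c'
    rw [Equiv.eq_symm_apply, hE]
    simp [swapLabel, hmn, hnp.symm, hEm, hEn, hEp]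
  have hcorner : ∀ (f : QubitChoice d) s t k, cornerLabel f m n s t k = E.symm (f m s, f n t, f p k) := by
    intro f s t k
    rw [Equiv.eq_symm_apply, hE]
    simp [cornerLabel, hmn.symm, hmp.symm, hnp.symm]
  have key := sum_three_orderEmb_le hd
    (fun i i' j j' k k' => ‖flipAmp φ {m} {n} (E.symm (i, j, k)) (E.symm (i', j', k'))‖ ^ 2)
    (fun _ _ _ _ _ _ => by positivity)
    (fun i i' j j' k k' => by
      have := flipAmp_swapLabel_left φ {m} {n} (E.symm (i, j, k)) (E.symm (i', j', k'))
      rw [hsm, hsm] at this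
      simp only [this, norm_neg])
    (fun i j j' k k' => by
      simp [flipAmp_eq_zero_left φ (a := m) {n} (x := E.symm (i, j, k)) (y := E.symm (i, j', k'))
        (by rw [hEm, hEm])])
    (fun i i' j j' k k' => by
      have := flipAmp_swapLabel_left φ {n} {m} (E.symm (i, j, k)) (E.symm (i', j', k'))
      rw [hsn, hsn] at this
      simp only [flipAmp_comm φ {m} {n}, this, norm_neg])
    (fun i i' j k k' => by
      simp [flipAmp_comm φ {m} {n}, flipAmp_eq_zero_left φ (a := n) {m} (x := E.symm (i, j, k))
        (y := E.symm (i', j, k')) (by rw [hEn, hEn])])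
  have hleft : ∑ f : QubitChoice d, ∑ s, ∑ t,
      ‖flipAmp φ {m} {n} (cornerLabel f m n 0 0 s) (cornerLabel f m n 1 1 t)‖ ^ 2 =
      ∑ f₁ : Fin 2 ↪o Fin (d m), ∑ f₂ : Fin 2 ↪o Fin (d n), ∑ f₃ : Fin 2 ↪o Fin (d p), ∑ k, ∑ l,
        ‖flipAmp φ {m} {n} (E.symm (f₁ 0, f₂ 0, f₃ k)) (E.symm (f₁ 1, f₂ 1, f₃ l))‖ ^ 2 := by
    simp only [hcorner]
    refine (Fintype.sum_equiv (tripleEquiv (fun i => Fin 2 ↪o Fin (d i)) hmn hmp hnp) _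
      (fun z => ∑ k, ∑ l, ‖flipAmp φ {m} {n} (E.symm (z.1 0, z.2.1 0, z.2.2 k))
        (E.symm (z.1 1, z.2.1 1, z.2.2 l))‖ ^ 2) fun f => rfl).trans ?_
    simp only [Fintype.sum_prod_type]
  have hright : ∑ q : BasisIdx d × BasisIdx d, ‖flipAmp φ {m} {n} q.1 q.2‖ ^ 2 =
      ∑ i, ∑ i', ∑ j, ∑ j', ∑ k, ∑ k',
        ‖flipAmp φ {m} {n} (E.symm (i, j, k)) (E.symm (i', j', k'))‖ ^ 2 := by
    have hsum : ∀ F : BasisIdx d → ℝ, ∑ x, F x = ∑ i, ∑ j, ∑ k, F (E.symm (i, j, k)) := fun F => by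
      rw [← E.symm.sum_comp, Fintype.sum_prod_type]
      simp only [Fintype.sum_prod_type]
    rw [Fintype.sum_prod_type, hsum]
    simp only [hsum]
    refine Finset.sum_congr rfl fun i _ => ?_
    rw [Finset.sum_comm (f := fun i' j => ∑ j', ∑ k, ∑ k',
      ‖flipAmp φ {m} {n} (E.symm (i, j, k)) (E.symm (i', j', k'))‖ ^ 2)]
    refine Finset.sum_congr rfl fun j _ => ?_
    rw [Finset.sum_comm]
    exact Finset.sum_congr rfl fun i' _ => Finset.sum_comm
  rw [hleft, hright]
  exact key

end Counting

/-! ### From pure states to ensembles. -/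

/-- Minkowski by duality: ‖X‖² ≤ ∑ q_k ⟨X, c_k⟩ ≤ ‖X‖ ∑ q_k R_k, then divide by ‖X‖. -/
theorem sqrt_sum_sq_le_of_le_sum {β : Type*} (S : Finset β) {N : ℕ} (X : β → ℝ) (q R : Fin N → ℝ)
    (c : Fin N → β → ℝ) (hX : ∀ s ∈ S, 0 ≤ X s) (hq : ∀ k, 0 ≤ q k)
    (hXc : ∀ s ∈ S, X s ≤ ∑ k, q k * c k s) (hR : ∀ k, √(∑ s ∈ S, c k s ^ 2) ≤ R k) :
    √(∑ s ∈ S, X s ^ 2) ≤ ∑ k, q k * R k := by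
  have h1 : ∑ s ∈ S, X s ^ 2 ≤ √(∑ s ∈ S, X s ^ 2) * ∑ k, q k * R k := by
    calc ∑ s ∈ S, X s ^ 2 ≤ ∑ s ∈ S, X s * ∑ k, q k * c k s := by
          refine Finset.sum_le_sum fun s hs => ?_
          rw [sq]
          exact mul_le_mul_of_nonneg_left (hXc s hs) (hX s hs)
      _ = ∑ k, q k * ∑ s ∈ S, X s * c k s := by
          simp only [Finset.mul_sum]
          rw [Finset.sum_comm]
          refine Finset.sum_congr rfl fun k _ => Finset.sum_congr rfl fun s _ => by ring
      _ ≤ ∑ k, q k * (√(∑ s ∈ S, X s ^ 2) * R k) := by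
          refine Finset.sum_le_sum fun k _ => mul_le_mul_of_nonneg_left ?_ (hq k)
          exact (Real.sum_mul_le_sqrt_mul_sqrt S X (c k)).trans
            (mul_le_mul_of_nonneg_left (hR k) (Real.sqrt_nonneg _))
      _ = _ := by
          rw [Finset.mul_sum]
          refine Finset.sum_congr rfl fun k _ => by ring
  have hR0 : 0 ≤ ∑ k, q k * R k :=
    Finset.sum_nonneg fun k _ => mul_nonneg (hq k) ((Real.sqrt_nonneg _).trans (hR k))
  rcases (Real.sqrt_nonneg (∑ s ∈ S, X s ^ 2)).eq_or_lt with h0 | h0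
  · rwa [← h0]
  · refine le_of_mul_le_mul_left ?_ h0
    rwa [Real.mul_self_sqrt (Finset.sum_nonneg fun s _ => sq_nonneg _)]

/-- The monogamy-type bound for pure states: the concurrence dominates the Frobenius norms of the
spin-flip forms of all two-qubit reductions of all substates. -/
theorem sum_substates_le_pureConcurrence {d : Fin 3 → ℕ} (hd : ∀ i, 2 ≤ d i) (φ : PureVec d)
    (hφ : ‖φ‖ = 1) :
    ∑ f : QubitChoice d, ∑ m : Fin 3, ∑ n ∈ Finset.Ioi m, ∑ s, ∑ t,
      ‖flipAmp φ {m} {n} (cornerLabel f m n 0 0 s) (cornerLabel f m n 1 1 t)‖ ^ 2 ≤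
    (((d 0 : ℝ) - 1) * ((d 1 : ℝ) - 1) * ((d 2 : ℝ) - 1)) * pureConcurrence φ ^ 2 := by
  have hd' : ∀ i, (1 : ℝ) ≤ (d i : ℝ) - 1 := fun i => by
    have : (2 : ℝ) ≤ d i := by exact_mod_cast hd i
    linarith
  have h01 := sum_substates_flipAmp_le (m := 0) (n := 1) (p := 2) (by decide) (by decide) (by decide)
    (hd 2) φ
  have h02 := sum_substates_flipAmp_le (m := 0) (n := 2) (p := 1) (by decide) (by decide) (by decide)
    (hd 1) φ
  have h12 := sum_substates_flipAmp_le (m := 1) (n := 2) (p := 0) (by decide) (by decide) (by decide)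
    (hd 0) φ
  have hC := pureConcurrence_three φ hφ
  have i0 : Finset.Ioi (0 : Fin 3) = {1, 2} := by decide
  have i1 : Finset.Ioi (1 : Fin 3) = {2} := by decide
  have i2 : Finset.Ioi (2 : Fin 3) = ∅ := by decide
  simp only [Fin.sum_univ_three, i0, i1, i2, Finset.sum_empty, Finset.sum_singleton, add_zero,
    Finset.sum_pair (show (1 : Fin 3) ≠ 2 by decide), Finset.sum_add_distrib]
  -- Each pair of parties costs only the factor of the third one; it is enlarged to the full product
  -- to get a common constant.
  have hP : ∀ a b c : ℝ, 1 ≤ a → 1 ≤ b → 1 ≤ c → c ≤ a * b * c := fun a b c ha hb hc => by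
    nlinarith [mul_nonneg (sub_nonneg.2 ha) (sub_nonneg.2 hb)]
  have p2 := hP _ _ _ (hd' 0) (hd' 1) (hd' 2)
  have p1 := hP _ _ _ (hd' 0) (hd' 2) (hd' 1)
  have p0 := hP _ _ _ (hd' 1) (hd' 2) (hd' 0)
  rw [mul_right_comm] at p1
  rw [mul_comm, ← mul_assoc] at p0
  have g01 := h01.trans (mul_le_mul_of_nonneg_right p2 (by positivity))
  have g02 := h02.trans (mul_le_mul_of_nonneg_right p1 (by positivity))
  have g12 := h12.trans (mul_le_mul_of_nonneg_right p0 (by positivity))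
  have := congrArg (fun z => (((d 0 : ℝ) - 1) * ((d 1 : ℝ) - 1) * ((d 2 : ℝ) - 1)) * z) hC
  simp only [mul_add] at this
  linarith

theorem theorem1 (d : Fin 3 → ℕ) (hd : ∀ i, 2 ≤ d i) (ρ : Op d) (hρ : IsState ρ) :
    concurrence ρ ≥
      1 / √(((d 0 : ℝ) - 1) * ((d 1 : ℝ) - 1) * ((d 2 : ℝ) - 1)) *
        √(∑ f : QubitChoice d, ∑ m : Fin 3, ∑ n ∈ Finset.Ioi m,
            concurrence (reducedState {m, n} (qubitSubstate ρ f)) ^ 2) := by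
  have : Nonempty (BasisIdx d) := ⟨fun i => ⟨0, by linarith [hd i]⟩⟩
  refine le_csInf (ensembleAverages_nonempty hρ.1) ?_
  rintro c ⟨N, q, φ, hq, hφ, rfl, rfl⟩
  have hd' : ∀ i, (0 : ℝ) < (d i : ℝ) - 1 := fun i => by
    have : (2 : ℝ) ≤ d i := by exact_mod_cast hd i
    linarith
  set P : ℝ := ((d 0 : ℝ) - 1) * ((d 1 : ℝ) - 1) * ((d 2 : ℝ) - 1) with hP
  have hPpos : 0 < P := mul_pos (mul_pos (hd' 0) (hd' 1)) (hd' 2)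
  have hflat : ∀ G : QubitChoice d → Fin 3 → Fin 3 → ℝ,
      ∑ f, ∑ m, ∑ n ∈ Finset.Ioi m, G f m n =
        ∑ s ∈ Finset.univ ×ˢ Finset.univ.sigma (fun m : Fin 3 => Finset.Ioi m),
          G s.1 s.2.1 s.2.2 := fun G => by
    rw [Finset.sum_product]
    simp only [Finset.sum_sigma]
  rw [hflat, one_div, inv_mul_le_iff₀ (Real.sqrt_pos.2 hPpos)]
  refine (sqrt_sum_sq_le_of_le_sum _ _ q (fun k => √P * pureConcurrence (φ k))
    (fun k s => √(∑ x, ∑ y, ‖flipAmp (φ k) {s.2.1} {s.2.2} (cornerLabel s.1 s.2.1 s.2.2 0 0 x)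
        (cornerLabel s.1 s.2.1 s.2.2 1 1 y)‖ ^ 2))
    (fun s _ => concurrence_nonneg _) hq ?_ ?_).trans_eq ?_
  · rintro ⟨f, m, n⟩ hs
    have hlt : m < n := by simpa using hs
    obtain ⟨p, hmp, hnp⟩ : ∃ p, m ≠ p ∧ n ≠ p := by
      clear hs hlt; revert m n; decide
    exact concurrence_reducedState_qubitSubstate_le hlt.ne hmp hnp f q hq φ
  · intro k
    rw [← Real.sqrt_sq (pureConcurrence_nonneg (φ k)), ← Real.sqrt_mul hPpos.le]
    refine Real.sqrt_le_sqrt ?_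
    refine le_trans (le_of_eq ?_) (sum_substates_le_pureConcurrence hd (φ k) (hφ k))
    rw [hflat]
    refine Finset.sum_congr rfl fun s _ => Real.sq_sqrt (by positivity)
  · rw [Finset.mul_sum]
    refine Finset.sum_congr rfl fun k _ => by ring
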